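/- Let $\mathscr{V}$ be a symmetric monoidal closed category (no limits or colimits in $\mathscr{V}$ are assumed), let $\mathscr{B}$ be a $\mathscr{V}$-category, and let $\mathscr{E},\mathscr{M}$ be classes of morphisms of (the underlying ordinary category of) $\mathscr{B}$. For morphisms $e:A_1\to A_2$ and $m:B_1\to B_2$ of $\mathscr{B}$, say that $e$ is $\mathscr{V}$-orthogonal to $m$ if the square with sides $\mathscr{B}(A_2,m)$, $\mathscr{B}(e,B_1)$, $\mathscr{B}(e,B_2)$, $\mathscr{B}(A_1,m)$ is a pullback in $\mathscr{V}$. The pair $(\mathscr{E},\mathscr{M})$ is a $\mathscr{V}$-prefactorization-system if $\mathscr{M}$ is exactly the class of morphisms to which every $e\in\mathscr{E}$ is $\mathscr{V}$-orthogonal and $\mathscr{E}$ is exactly the class of morphisms that are $\mathscr{V}$-orthogonal to every $m\in\mathscr{M}$. It is $\mathscr{V}$-proper if every $m\in\mathscr{M}$ is a $\mathscr{V}$-mono (each $\mathscr{B}(A,m)$ is a monomorphism in $\mathscr{V}$) and every $e\in\mathscr{E}$ is a $\mathscr{V}$-epi (each $\mathscr{B}(e,A)$ is a monomorphism in $\mathscr{V}$).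 For such a pair, $\mathscr{B}$ is $\mathscr{M}$-subobject-complete if $\mathscr{B}$ is cotensored, has $\mathscr{V}$-intersections (that is, $\mathscr{V}$-fibre-products) of arbitrary class-indexed families of $\mathscr{M}$-morphisms with a common codomain, and has $\mathscr{V}$-pullbacks of $\mathscr{M}$-morphisms along arbitrary morphisms; here a $\mathscr{V}$-limit is a limit in the underlying ordinary category that is preserved by every functor $\mathscr{B}(A,-):\mathscr{B}\to\mathscr{V}$. A $\mathscr{V}$-monad $\mathbb{S}=(S,\rho,\lambda)$ on $\mathscr{B}$ is idempotent if $\lambda:SS\to S$ is an isomorphism. An idempotent $\mathscr{V}$-core of a $\mathscr{V}$-monad $\mathbb{T}=(T,\eta,\mu)$ on $\mathscr{B}$ is an idempotent $\mathscr{V}$-monad $\widetilde{\mathbb{T}}$ on $\mathscr{B}$ whose underlying endofunctor $\widetilde{T}$ inverts the same morphisms as $T$: for every morphism $f$ of $\mathscr{B}$, $\widetilde{T}f$ is an isomorphism if and only if $Tf$ is. **Corollary.** Let $(\mathscr{E},\mathscr{M})$ be a $\mathscr{V}$-proper $\mathscr{V}$-prefactorization-system on $\mathscr{B}$, and suppose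 that $\mathscr{B}$ is $\mathscr{M}$-subobject-complete. Then every $\mathscr{V}$-monad $\mathbb{T}$ on $\mathscr{B}$ has an idempotent $\mathscr{V}$-core. -/

import Mathlib

open CategoryTheory MonoidalCategory Limits

universe v₁ v₂ u₁ u₂

namespace EnrichedCore

/-
A `V`-category is presented by `EnrichedOrdinaryCategory V B`: an enriched category together
with its underlying ordinary category, whose morphisms `X ⟶ Y` correspond to the morphisms
`𝟙_ V ⟶ (X ⟶[V] Y)`. For a morphism `f` of the underlying category, `eHomWhiskerLeft V A f` is
the morphism `B(A, f)` of `V`, and `eHomWhiskerRight V f A` is the morphism `B(f, A)`.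
-/

section Orthogonality

variable (V : Type u₁) [Category.{v₁} V] [MonoidalCategory V]
  {B : Type u₂} [Category.{v₂} B] [EnrichedOrdinaryCategory V B]

/-- `m` is a `V`-monomorphism: every `B(A, m)` is a monomorphism in `V`. -/
def IsVMono {X Y : B} (m : X ⟶ Y) : Prop :=
  ∀ A : B, Mono (eHomWhiskerLeft V A m)

/-- `e` is a `V`-epimorphism, that is, a `V`-monomorphism in the opposite `V`-category:
every `B(e, A)` is a monomorphism in `V`. -/
def IsVEpi {X Y : B} (e : X ⟶ Y) : Prop :=
  ∀ A : B, Mono (eHomWhiskerRight V e A)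

/-- `e` is `V`-orthogonal to `m`: the commutative square with sides `B(A₂, m)`, `B(e, B₁)`,
`B(e, B₂)`, `B(A₁, m)` is a pullback in `V`. -/
def VOrthogonal {A₁ A₂ B₁ B₂ : B} (e : A₁ ⟶ A₂) (m : B₁ ⟶ B₂) : Prop :=
  IsPullback (eHomWhiskerLeft V A₂ m) (eHomWhiskerRight V e B₁)
    (eHomWhiskerRight V e B₂) (eHomWhiskerLeft V A₁ m)

/-- The class of the morphisms to which every morphism of `E` is `V`-orthogonal. -/
def vRightOrthogonal (E : MorphismProperty B) : MorphismProperty B :=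
  fun _ _ m => ∀ ⦃A₁ A₂ : B⦄ (e : A₁ ⟶ A₂), E e → VOrthogonal V e m

/-- The class of the morphisms that are `V`-orthogonal to every morphism of `M`. -/
def vLeftOrthogonal (M : MorphismProperty B) : MorphismProperty B :=
  fun _ _ e => ∀ ⦃B₁ B₂ : B⦄ (m : B₁ ⟶ B₂), M m → VOrthogonal V e m

/-- `(E, M)` is a `V`-prefactorization-system. -/
structure IsVPrefactorizationSystem (E M : MorphismProperty B) : Prop where
  right_eq : vRightOrthogonal V E = M
  left_eq : vLeftOrthogonal V M = E

/-- The pair `(E, M)` is `V`-proper. -/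
structure IsVProper (E M : MorphismProperty B) : Prop where
  vEpi : ∀ ⦃X Y : B⦄ (e : X ⟶ Y), E e → IsVEpi V e
  vMono : ∀ ⦃X Y : B⦄ (m : X ⟶ Y), M m → IsVMono V m

end Orthogonality

section Completeness

variable (V : Type u₁) [Category.{v₁} V] [MonoidalCategory V] [SymmetricCategory V]
  [MonoidalClosed V] {B : Type u₂} [Category.{v₂} B] [EnrichedOrdinaryCategory V B]

/-- The morphism `B(A, P) ⟶ [v, B(A, X)]` of `V` induced by `ε : v ⟶ B(P, X)`. -/
noncomputable def cotensorComparison {v : V} {X P : B} (ε : v ⟶ (P ⟶[V] X)) (A : B) :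
    (A ⟶[V] P) ⟶ (ihom v).obj (A ⟶[V] X) :=
  MonoidalClosed.curry ((β_ v (A ⟶[V] P)).hom ≫ (A ⟶[V] P) ◁ ε ≫ eComp V A P X)

/-- `P`, with counit `ε : v ⟶ B(P, X)`, is a cotensor of `X` by `v`: the induced `V`-natural
morphisms `B(A, P) ⟶ [v, B(A, X)]` are isomorphisms. -/
def IsCotensor (v : V) (X P : B) (ε : v ⟶ (P ⟶[V] X)) : Prop :=
  ∀ A : B, IsIso (cotensorComparison V ε A)

variable (B) in
/-- `B` is cotensored. -/
def IsCotensored : Prop :=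
  ∀ (v : V) (X : B), ∃ (P : B) (ε : v ⟶ (P ⟶[V] X)), IsCotensor V v X P ε

/-- `B` is `M`-subobject-complete as a `V`-category. Here `V`-limits are conical limits: limits in
the underlying category that are preserved by all `B(A, -)`. A `V`-intersection is a
`V`-fibre-product of a family of morphisms with a common codomain. The index types range over a
universe that contains the type of all morphisms of `B` into a given object, so that
intersections of families of any size (class-indexed families) are covered. -/
structure IsSubobjectComplete (M : MorphismProperty B) : Prop where
  cotensored : IsCotensored V B
  intersections : ∀ (I : Type (max u₂ v₂)) (Y : B) (X : I → B) (m : ∀ i, X i ⟶ Y),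
    (∀ i, M (m i)) → Enriched.HasConicalLimit V (WidePullbackShape.wideCospan Y X m)
  pullbacks : ∀ ⦃X Y Z : B⦄ (f : X ⟶ Z) (m : Y ⟶ Z), M m →
    Enriched.HasConicalPullback V f m

end Completeness

section Monads

variable {V : Type u₁} [Category.{v₁} V] [MonoidalCategory V]
  {B : Type u₂} [Category.{v₂} B] [EnrichedOrdinaryCategory V B]

/-- The underlying ordinary functor of a `V`-functor. -/
def underlying (F : EnrichedFunctor V B B) : B ⥤ B where
  obj := F.obj
  map {X Y} f := (eHomEquiv V).symm (eHomEquiv V f ≫ F.map X Y)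
  map_id X := by
    apply (eHomEquiv V).injective
    simp
  map_comp {X Y Z} f g := by
    apply (eHomEquiv V).injective
    simp [eHomEquiv_comp]

/-- A `V`-natural transformation between `V`-functors: a family of morphisms of the underlying
category satisfying the `V`-naturality condition, an equality of two morphisms
`B(X, Y) ⟶ B(F X, G Y)` of `V`. (Mathlib's `EnrichedNatTrans` only asks for the weaker naturality
with respect to the morphisms of the underlying ordinary category.) -/
@[ext]
structure VNatTrans (F G : EnrichedFunctor V B B) where
  app : ∀ X : B, F.obj X ⟶ G.obj X
  naturality : ∀ X Y : B,
    F.map X Y ≫ eHomWhiskerLeft V (F.obj X) (app Y) =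
      G.map X Y ≫ eHomWhiskerRight V (app X) (G.obj Y)

variable (V B) in
/-- A `V`-monad on `B`. -/
structure VMonad where
  /-- The underlying `V`-functor. -/
  T : EnrichedFunctor V B B
  /-- The unit. -/
  η : VNatTrans (EnrichedFunctor.id V B) T
  /-- The multiplication. -/
  μ : VNatTrans (T.comp V T) T
  assoc : ∀ X : B, (underlying T).map (μ.app X) ≫ μ.app X = μ.app (T.obj X) ≫ μ.app X
  left_unit : ∀ X : B, η.app (T.obj X) ≫ μ.app X = 𝟙 (T.obj X)
  right_unit : ∀ X : B, (underlying T).map (η.app X) ≫ μ.app X = 𝟙 (T.obj X)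

/-- The `V`-monad is idempotent: its multiplication has an inverse `V`-natural transformation. -/
def VMonad.IsIdempotent (S : VMonad V B) : Prop :=
  ∃ ν : VNatTrans S.T (S.T.comp V S.T),
    (∀ X : B, S.μ.app X ≫ ν.app X = 𝟙 ((S.T.comp V S.T).obj X)) ∧
    (∀ X : B, ν.app X ≫ S.μ.app X = 𝟙 (S.T.obj X))

/-- `S` is an idempotent `V`-core of `T`: it is idempotent, and its underlying endofunctor inverts
the same morphisms as that of `T`. -/
structure VMonad.IsIdempotentCore (S T : VMonad V B) : Prop where
  idempotent : S.IsIdempotent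
  inverts_iff : ∀ ⦃X Y : B⦄ (f : X ⟶ Y),
    IsIso ((underlying S.T).map f) ↔ IsIso ((underlying T.T).map f)

end Monads

end EnrichedCore

/-!
Call a morphism `f` inverted if `T f` is invertible, and call an object `Z` local if `B(f, Z)` is
invertible for every inverted `f`. The idempotent core is the `V`-reflection onto the local objects.
It exists as soon as every object `X` has an inverted morphism `r : X ⟶ K X` to a local object:
then `B(r X, K Y)` is invertible, which makes `K` an idempotent `V`-monad (`reflectionMonad`). It
inverts the inverted morphisms because its values are local (`isIso_reflectionHom`), and it inverts
no others because `T` sends the naturality square of `r` at `f` to one whose two sides `T (r X)` and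
`T (r Y)` are invertible.

The morphism `r` is found in `VMonad.exists_reflection`. The objects `T X` are local: the inverse of
`B(f, T X)` is built from the action of `T`, the unit and the multiplication
(`VMonad.isIso_eHomWhiskerRight_of_inverted`). Let `N` be the class of the morphisms to which the
members of `E` and the inverted morphisms are `V`-orthogonal. It is contained in `M` and closed
under composition, `V`-pullbacks and `V`-intersections. Let `n : K ⟶ T X` be the intersection of the
`N`-subobjects of `T X` through which the unit `X ⟶ T X` factors, and `r : X ⟶ K` the induced
morphism. Since `n` is in `N` and `T X` is local, so is `K`. It remains to invert `T r`:

* `T r` is a split monomorphism, because `r ≫ n` is the unit and `T` of the unit is split by the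
  multiplication;
* the members of `E` are `V`-epimorphisms, so they are `V`-orthogonal to the split monomorphism
  `T r`; and `T r` goes between local objects. Hence `T r` is in `N`;
* the pullback of `T r` along the unit `K ⟶ T K` is an `N`-subobject of `K` through which `r`
  factors. By minimality of `K` it has a section, that is, the unit of `K` lifts along `T r`. This
  lift yields a section of `T r` (`VMonad.inverted_of_extension_of_lift`).

The absence of products and equalizers is harmless because the only subobject of `T K` that has to
be formed is the split one `T r`.
-/

namespace EnrichedCore

/-! ### Whiskering and the underlying category -/

section Whiskering

variable (V : Type u₁) [Category.{v₁} V] [MonoidalCategory V]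
  {B : Type u₂} [Category.{v₂} B] [EnrichedOrdinaryCategory V B]

lemma eHomEquiv_comp_eq_whiskerLeft {X Y Z : B} (f : X ⟶ Y) (g : Y ⟶ Z) :
    eHomEquiv V (f ≫ g) = eHomEquiv V f ≫ eHomWhiskerLeft V X g := by
  rw [eHomEquiv_comp, eHomWhiskerLeft, MonoidalCategory.tensorHom_def]
  simp [unitors_inv_equal]

lemma eHomEquiv_comp_eq_whiskerRight {X Y Z : B} (f : X ⟶ Y) (g : Y ⟶ Z) :
    eHomEquiv V (f ≫ g) = eHomEquiv V g ≫ eHomWhiskerRight V f Z := by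
  rw [eHomEquiv_comp, eHomWhiskerRight, tensorHom_def']
  simp

/-- Dinaturality of the enriched composition in the middle variable. -/
lemma whiskerRight_eHomWhiskerLeft_eComp (X : B) {Y Y' : B} (g : Y ⟶ Y') (Z : B) :
    eHomWhiskerLeft V X g ▷ (Y' ⟶[V] Z) ≫ eComp V X Y' Z =
      (X ⟶[V] Y) ◁ eHomWhiskerRight V g Z ≫ eComp V X Y Z := by
  simp only [eHomWhiskerLeft, eHomWhiskerRight, comp_whiskerRight, Category.assoc,
    MonoidalCategory.whiskerLeft_comp, whisker_assoc, e_assoc]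
  simp

variable {V} in
lemma IsVMono.mono {X Y : B} {m : X ⟶ Y} (hm : IsVMono V m) : Mono m where
  right_cancellation {Z} g h w := by
    have := hm Z
    apply (eHomEquiv V).injective
    rw [← cancel_mono (eHomWhiskerLeft V Z m), ← eHomEquiv_comp_eq_whiskerLeft,
      ← eHomEquiv_comp_eq_whiskerLeft, w]

/-- If `B(f, Z)` is invertible, then every morphism to `Z` extends along `f`. -/
lemma exists_extension {X Y Z : B} (f : X ⟶ Y) [IsIso (eHomWhiskerRight V f Z)] (g : X ⟶ Z) :
    ∃ g' : Y ⟶ Z, f ≫ g' = g := by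
  refine ⟨(eHomEquiv V).symm (eHomEquiv V g ≫ inv (eHomWhiskerRight V f Z)),
    (eHomEquiv V).injective ?_⟩
  rw [eHomEquiv_comp_eq_whiskerRight, Equiv.apply_symm_apply, Category.assoc,
    IsIso.inv_hom_id, Category.comp_id]

/-- If `B(f, Z)` is a monomorphism, then a morphism to `Z` has at most one extension along `f`. -/
lemma extension_ext {X Y Z : B} (f : X ⟶ Y) [Mono (eHomWhiskerRight V f Z)] {g h : Y ⟶ Z}
    (w : f ≫ g = f ≫ h) : g = h := by
  apply (eHomEquiv V).injective
  rw [← cancel_mono (eHomWhiskerRight V f Z), ← eHomEquiv_comp_eq_whiskerRight,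
    ← eHomEquiv_comp_eq_whiskerRight, w]

end Whiskering

/-! ### Orthogonality in the enriched sense -/

section Orthogonality

variable {V : Type u₁} [Category.{v₁} V] [MonoidalCategory V]
  {B : Type u₂} [Category.{v₂} B] [EnrichedOrdinaryCategory V B]

lemma VOrthogonal.of_isIso {A₁ A₂ B₁ B₂ : B} (e : A₁ ⟶ A₂) (m : B₁ ⟶ B₂)
    [IsIso (eHomWhiskerRight V e B₁)] [IsIso (eHomWhiskerRight V e B₂)] :
    VOrthogonal V e m :=
  IsPullback.of_vert_isIso ⟨eHom_whisker_exchange V e m⟩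

/-- If `e` is `V`-orthogonal to `m`, and to the codomain of `m` in the sense that `B(e, B₂)` is
invertible, then it is `V`-orthogonal to the domain of `m`. -/
lemma VOrthogonal.isIso {A₁ A₂ B₁ B₂ : B} {e : A₁ ⟶ A₂} {m : B₁ ⟶ B₂}
    (h : VOrthogonal V e m) [IsIso (eHomWhiskerRight V e B₂)] :
    IsIso (eHomWhiskerRight V e B₁) :=
  IsPullback.isIso_snd_of_isIso h

lemma VOrthogonal.comp {A₁ A₂ B₁ B₂ B₃ : B} {e : A₁ ⟶ A₂} {m : B₁ ⟶ B₂} {n : B₂ ⟶ B₃}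
    (hm : VOrthogonal V e m) (hn : VOrthogonal V e n) : VOrthogonal V e (m ≫ n) := by
  unfold VOrthogonal at *
  simpa using hm.paste_horiz hn

/-- The right `V`-orthogonal class of a morphism is stable under `V`-pullback. -/
lemma VOrthogonal.of_isPullback {A₁ A₂ P X Y Z : B} {e : A₁ ⟶ A₂} {fst : P ⟶ X} {snd : P ⟶ Y}
    {f : X ⟶ Z} {m : Y ⟶ Z}
    (hP : ∀ A : B, IsPullback (eHomWhiskerLeft V A fst) (eHomWhiskerLeft V A snd)
      (eHomWhiskerLeft V A f) (eHomWhiskerLeft V A m))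
    (h : VOrthogonal V e m) : VOrthogonal V e fst := by
  have hs := (hP A₂).flip.paste_horiz (IsPullback.flip h)
  rw [eHom_whisker_exchange, eHom_whisker_exchange] at hs
  exact (hs.of_right (eHom_whisker_exchange V e fst).symm (hP A₁).flip).flip

variable (V) in
/-- `n : K ⟶ Y`, with the projections `π`, is a `V`-fibre-product of the family `m`: each `B(A, -)`
sends it to a fibre product in `V`. The index type may be empty, in which case `n` is invertible.
This is the elementwise form of a conical limit of `WidePullbackShape.wideCospan`. -/
structure IsVFibreProduct {I : Type*} {Y K : B} {X : I → B} (m : ∀ i, X i ⟶ Y) (n : K ⟶ Y)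
    (π : ∀ i, K ⟶ X i) : Prop where
  w : ∀ i, π i ≫ m i = n
  hom_ext : ∀ {A : B} {P : V} {f g : P ⟶ (A ⟶[V] K)},
    f ≫ eHomWhiskerLeft V A n = g ≫ eHomWhiskerLeft V A n →
    (∀ i, f ≫ eHomWhiskerLeft V A (π i) = g ≫ eHomWhiskerLeft V A (π i)) → f = g
  exists_lift : ∀ {A : B} {P : V} (b : P ⟶ (A ⟶[V] Y)) (a : ∀ i, P ⟶ (A ⟶[V] X i)),
    (∀ i, a i ≫ eHomWhiskerLeft V A (m i) = b) →
    ∃ l : P ⟶ (A ⟶[V] K), l ≫ eHomWhiskerLeft V A n = b ∧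
      ∀ i, l ≫ eHomWhiskerLeft V A (π i) = a i

lemma exists_isVFibreProduct {I : Type*} {Y : B} {X : I → B} (m : ∀ i, X i ⟶ Y)
    [Enriched.HasConicalLimit V (WidePullbackShape.wideCospan Y X m)] :
    ∃ (K : B) (n : K ⟶ Y) (π : ∀ i, K ⟶ X i), IsVFibreProduct V m n π := by
  let F := WidePullbackShape.wideCospan Y X m
  have hl (A : B) := isLimitOfPreserves (eCoyoneda V A) (limit.isLimit F)
  refine ⟨limit F, limit.π F none, fun i => limit.π F (some i),
    fun i => limit.w F (WidePullbackShape.Hom.term i), fun {A P f g} h h' => ?_,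
    fun {A P} b a w => ?_⟩
  · refine (hl A).hom_ext fun j => ?_
    cases j with
    | none => exact h
    | some i => exact h' i
  · let c : Cone (F ⋙ eCoyoneda V A) := WidePullbackShape.mkCone (X := P) b a w
    exact ⟨(hl A).lift c, (hl A).fac c none, fun i => (hl A).fac c (some i)⟩

/-- The right `V`-orthogonal class of a morphism is closed under `V`-intersections. -/
lemma IsVFibreProduct.vOrthogonal {A₁ A₂ : B} {e : A₁ ⟶ A₂} {I : Type*} {Y K : B} {X : I → B}
    {m : ∀ i, X i ⟶ Y} {n : K ⟶ Y} {π : ∀ i, K ⟶ X i} (hn : IsVFibreProduct V m n π)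
    (h : ∀ i, VOrthogonal V e (m i)) : VOrthogonal V e n := by
  have key (c : PullbackCone (eHomWhiskerRight V e Y) (eHomWhiskerLeft V A₁ n)) :
      ∃ l : c.pt ⟶ (A₂ ⟶[V] K), l ≫ eHomWhiskerLeft V A₂ n = c.fst ∧
        l ≫ eHomWhiskerRight V e K = c.snd := by
    have hc (i) : c.fst ≫ eHomWhiskerRight V e Y =
        (c.snd ≫ eHomWhiskerLeft V A₁ (π i)) ≫ eHomWhiskerLeft V A₁ (m i) := by
      rw [c.condition, Category.assoc, ← eHomWhiskerLeft_comp, hn.w]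
    obtain ⟨l, hl, hl'⟩ := hn.exists_lift c.fst (fun i => (h i).lift _ _ (hc i))
      (fun i => (h i).lift_fst _ _ _)
    refine ⟨l, hl, hn.hom_ext ?_ fun i => ?_⟩
    · rw [Category.assoc, ← eHom_whisker_exchange, reassoc_of% hl, c.condition]
    · rw [Category.assoc, ← eHom_whisker_exchange, reassoc_of% (hl' i)]
      exact (h i).lift_snd _ _ _
  choose l hl hl' using key
  refine ⟨⟨eHom_whisker_exchange V e n⟩, ⟨PullbackCone.IsLimit.mk _ l hl hl'
    fun c k hk hk' => hn.hom_ext (hk.trans (hl c).symm) fun i => ?_⟩⟩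
  refine (h i).hom_ext ?_ ?_
  · rw [Category.assoc, Category.assoc, ← eHomWhiskerLeft_comp, hn.w, hk, hl]
  · simp only [Category.assoc, eHom_whisker_exchange]
    rw [reassoc_of% hk', reassoc_of% (hl' c)]

/-- A `V`-epimorphism is `V`-orthogonal to every split monomorphism. -/
lemma IsVEpi.vOrthogonal {A₁ A₂ S W : B} {e : A₁ ⟶ A₂} (he : IsVEpi V e)
    {s : S ⟶ W} {p : W ⟶ S} (hs : s ≫ p = 𝟙 S) : VOrthogonal V e s := by
  have := he W
  have hs' (A : B) : eHomWhiskerLeft V A s ≫ eHomWhiskerLeft V A p = 𝟙 _ := by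
    rw [← eHomWhiskerLeft_comp, hs, eHomWhiskerLeft_id]
  refine ⟨⟨eHom_whisker_exchange V e s⟩, ⟨PullbackCone.IsLimit.mk _
    (fun c => c.fst ≫ eHomWhiskerLeft V A₂ p) (fun c => ?_) (fun c => ?_)
    (fun c l hl _ => ?_)⟩⟩
  · rw [← cancel_mono (eHomWhiskerRight V e W)]
    simp only [Category.assoc, eHom_whisker_exchange, eHom_whisker_exchange_assoc]
    rw [reassoc_of% c.condition, reassoc_of% (hs' A₁), c.condition]
  · rw [Category.assoc, eHom_whisker_exchange, reassoc_of% c.condition, hs', Category.comp_id]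
  · rw [← hl, Category.assoc, hs', Category.comp_id]

end Orthogonality

/-! ### Enriched functors and natural transformations on underlying morphisms -/

section Functors

variable {V : Type u₁} [Category.{v₁} V] [MonoidalCategory V]
  {B : Type u₂} [Category.{v₂} B] [EnrichedOrdinaryCategory V B]

/-- The action of a `V`-functor on the morphisms of the underlying category, that is, the action of
its underlying functor. Its type mentions `F.obj` and not `(underlying F).obj`, so that it composes
with the components of `V`-natural transformations without unfolding. -/
def mapHom (F : EnrichedFunctor V B B) {X Y : B} (f : X ⟶ Y) : F.obj X ⟶ F.obj Y :=
  (underlying F).map f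

lemma eHomEquiv_mapHom (F : EnrichedFunctor V B B) {X Y : B} (f : X ⟶ Y) :
    eHomEquiv V (mapHom F f) = eHomEquiv V f ≫ F.map X Y :=
  Equiv.apply_symm_apply _ _

lemma mapHom_comp (F : EnrichedFunctor V B B) {X Y Z : B} (f : X ⟶ Y) (g : Y ⟶ Z) :
    mapHom F (f ≫ g) = mapHom F f ≫ mapHom F g :=
  (underlying F).map_comp f g

lemma eHomWhiskerRight_comp_map (F : EnrichedFunctor V B B) {X X' : B} (f : X ⟶ X') (Y : B) :
    eHomWhiskerRight V f Y ≫ F.map X Y =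
      F.map X' Y ≫ eHomWhiskerRight V (mapHom F f) (F.obj Y) := by
  simp only [eHomWhiskerRight, Category.assoc, EnrichedFunctor.map_comp, eHomEquiv_mapHom]
  rw [leftUnitor_inv_naturality_assoc, comp_whiskerRight, MonoidalCategory.tensorHom_def]
  simp only [Category.assoc, ← whisker_exchange_assoc]

/-- `V`-naturality implies naturality with respect to the morphisms of the underlying category. -/
lemma VNatTrans.mapHom_naturality {F G : EnrichedFunctor V B B} (α : VNatTrans F G)
    {X Y : B} (f : X ⟶ Y) :
    mapHom F f ≫ α.app Y = α.app X ≫ mapHom G f := by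
  apply (eHomEquiv V).injective
  rw [eHomEquiv_comp_eq_whiskerRight V (α.app X), eHomEquiv_comp_eq_whiskerLeft,
    eHomEquiv_mapHom, eHomEquiv_mapHom, Category.assoc, Category.assoc, α.naturality]

/-- The morphisms inverted by the underlying functor of a `V`-functor. -/
def inverted (F : EnrichedFunctor V B B) : MorphismProperty B :=
  fun _ _ f => IsIso (mapHom F f)

end Functors

/-! ### Morphisms inverted by an enriched monad -/

section Monads

variable {V : Type u₁} [Category.{v₁} V] [MonoidalCategory V]
  {B : Type u₂} [Category.{v₂} B] [EnrichedOrdinaryCategory V B] (T : VMonad V B)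

namespace VMonad

/-- The component `X ⟶ T X` of the unit, with the identity `V`-functor removed from its type. -/
def unit (X : B) : X ⟶ T.T.obj X := T.η.app X

/-- The component `T (T X) ⟶ T X` of the multiplication, with the composite `V`-functor unfolded in
its type. -/
def mult (X : B) : T.T.obj (T.T.obj X) ⟶ T.T.obj X := T.μ.app X

lemma unit_naturality {X Y : B} (f : X ⟶ Y) : f ≫ T.unit Y = T.unit X ≫ mapHom T.T f := by
  have h : mapHom (EnrichedFunctor.id V B) f = f :=
    (eHomEquiv V).injective ((eHomEquiv_mapHom _ f).trans (Category.comp_id _))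
  have := T.η.mapHom_naturality f
  rw [h] at this
  exact this

lemma mult_naturality {X Y : B} (f : X ⟶ Y) :
    mapHom T.T (mapHom T.T f) ≫ T.mult Y = T.mult X ≫ mapHom T.T f := by
  have h : mapHom (T.T.comp V T.T) f = mapHom T.T (mapHom T.T f) :=
    (eHomEquiv V).injective <| (eHomEquiv_mapHom _ f).trans <| by
      refine Eq.trans ?_ (eHomEquiv_mapHom T.T (mapHom T.T f)).symm
      rw [eHomEquiv_mapHom, Category.assoc]
      rfl
  have := T.μ.mapHom_naturality f
  rw [h] at this
  exact this

lemma unit_comp_mult (X : B) : T.unit (T.T.obj X) ≫ T.mult X = 𝟙 (T.T.obj X) :=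
  T.left_unit X

lemma mapHom_unit_comp_mult (X : B) : mapHom T.T (T.unit X) ≫ T.mult X = 𝟙 (T.T.obj X) :=
  T.right_unit X

/-- The `V`-naturality of the unit. -/
lemma map_comp_whiskerRight_unit (X Y : B) :
    T.T.map X Y ≫ eHomWhiskerRight V (T.unit X) (T.T.obj Y) = eHomWhiskerLeft V X (T.unit Y) :=
  (T.η.naturality X Y).symm.trans (Category.id_comp _)

/-- The values of a `V`-monad `T` are `V`-orthogonal to the morphisms inverted by `T`. -/
lemma isIso_eHomWhiskerRight_of_inverted {A A' : B} (f : A ⟶ A')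
    (hf : inverted T.T f) (X : B) : IsIso (eHomWhiskerRight V f (T.T.obj X)) := by
  have : IsIso (mapHom T.T f) := hf
  have hX (A : B) : T.T.map A (T.T.obj X) ≫ eHomWhiskerRight V (T.unit A) _ ≫
      eHomWhiskerLeft V A (T.mult X) = 𝟙 _ := by
    rw [reassoc_of% (T.map_comp_whiskerRight_unit A), ← eHomWhiskerLeft_comp, unit_comp_mult,
      eHomWhiskerLeft_id]
  -- The inverse of `B(f, T X)` sends `g : A ⟶ T X` to `η_A' ≫ (T f)⁻¹ ≫ T g ≫ μ_X`.
  refine ⟨T.T.map A (T.T.obj X) ≫ eHomWhiskerRight V (inv (mapHom T.T f)) _ ≫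
    eHomWhiskerRight V (T.unit A') _ ≫ eHomWhiskerLeft V A' (T.mult X), ?_, ?_⟩
  · rw [reassoc_of% (eHomWhiskerRight_comp_map T.T f), ← eHomWhiskerRight_comp_assoc,
      IsIso.inv_hom_id, eHomWhiskerRight_id, Category.id_comp, hX]
  · simp only [Category.assoc, eHom_whisker_exchange]
    rw [← eHomWhiskerRight_comp_assoc, ← eHomWhiskerRight_comp_assoc,
      reassoc_of% (T.unit_naturality f), IsIso.hom_inv_id, Category.comp_id, hX]

/-- `T r` has a retraction if the unit at the domain of `r` extends along `r`, and a section if the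
unit at the codomain of `r` lifts along `T r`. -/
lemma inverted_of_extension_of_lift {X K : B} (r : X ⟶ K)
    (n : K ⟶ T.T.obj X) (hn : r ≫ n = T.unit X) (q : K ⟶ T.T.obj X)
    (hq : q ≫ mapHom T.T r = T.unit K) : inverted T.T r := by
  have h₁ : mapHom T.T r ≫ (mapHom T.T n ≫ T.mult X) = 𝟙 _ := by
    rw [← Category.assoc, ← mapHom_comp, hn, mapHom_unit_comp_mult]
  have h₂ : (mapHom T.T q ≫ T.mult X) ≫ mapHom T.T r = 𝟙 _ := by
    rw [Category.assoc, ← mult_naturality, ← Category.assoc, ← mapHom_comp, hq,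
      mapHom_unit_comp_mult]
  have : IsSplitMono (mapHom T.T r) := ⟨⟨⟨_, h₁⟩⟩⟩
  have : IsSplitEpi (mapHom T.T r) := ⟨⟨⟨_, h₂⟩⟩⟩
  exact isIso_of_epi_of_isSplitMono _

end VMonad

/-- The universal arrow from `X` to an object that is `V`-orthogonal to the morphisms inverted by
`T`: its codomain is the smallest among those `M`-subobjects of `T X` through which the unit factors
and to which all the morphisms inverted by `T` are `V`-orthogonal. -/
lemma VMonad.exists_reflection [SymmetricCategory V] [MonoidalClosed V] {E M : MorphismProperty B}
    (hEM : IsVPrefactorizationSystem V E M) (hproper : IsVProper V E M)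
    (hB : IsSubobjectComplete V M) (X : B) :
    ∃ (K : B) (r : X ⟶ K), inverted T.T r ∧
      ∀ ⦃A A' : B⦄ (f : A ⟶ A'), inverted T.T f → IsIso (eHomWhiskerRight V f K) := by
  let N := vRightOrthogonal V (E ⊔ inverted T.T)
  have N_M {Y Z : B} {m : Y ⟶ Z} (hm : N m) : M m :=
    hEM.right_eq ▸ fun _ _ e he => hm e (Or.inl he)
  let I := {p : Σ K : B, (K ⟶ T.T.obj X) // N p.2 ∧ ∃ r, r ≫ p.2 = T.unit X}
  have := hB.intersections I (T.T.obj X) (fun i => i.1.1) (fun i => i.1.2) fun i => N_M i.2.1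
  obtain ⟨K, n, π, hn⟩ := exists_isVFibreProduct (V := V) (fun i : I => i.1.2)
  have hnN : N n := fun _ _ e he => hn.vOrthogonal fun i => i.2.1 e he
  have hnm : Mono n := (hproper.vMono n (N_M hnN)).mono
  obtain ⟨r, hr⟩ : ∃ r, r ≫ n = T.unit X := by
    choose s hs using fun i : I => i.2.2
    obtain ⟨l, hl, -⟩ := hn.exists_lift (eHomEquiv V (T.unit X)) (fun i => eHomEquiv V (s i))
      fun i => by rw [← eHomEquiv_comp_eq_whiskerLeft, hs]
    refine ⟨(eHomEquiv V).symm l, (eHomEquiv V).injective ?_⟩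
    rw [eHomEquiv_comp_eq_whiskerLeft, Equiv.apply_symm_apply, hl]
  refine ⟨K, r, ?_, fun A A' f hf => ?_⟩
  · -- `T r` is a split monomorphism between values of `T`, so it belongs to `N`.
    have hTr : N (mapHom T.T r) := by
      rintro _ _ e (he | he)
      · refine (hproper.vEpi e he).vOrthogonal (p := mapHom T.T n ≫ T.mult X) ?_
        rw [← Category.assoc, ← mapHom_comp, hr, mapHom_unit_comp_mult]
      · have := T.isIso_eHomWhiskerRight_of_inverted e he
        exact VOrthogonal.of_isIso _ _
    have := hB.pullbacks (T.unit K) (mapHom T.T r) (N_M hTr)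
    let w := pullback.fst (T.unit K) (mapHom T.T r)
    have hw : N w := fun _ _ e he => VOrthogonal.of_isPullback
      (fun A => (IsPullback.of_hasPullback _ _).map (eCoyoneda V A)) (hTr e he)
    -- By minimality of `K`, the pullback of `T r` along the unit at `K` has a section.
    let i : I := ⟨⟨_, w ≫ n⟩, fun _ _ e he => (hw e he).comp (hnN e he),
      pullback.lift r (T.unit X) (T.unit_naturality r), by
        rw [pullback.lift_fst_assoc, hr]⟩
    have hi : π i ≫ w = 𝟙 K := by
      rw [← cancel_mono n, Category.assoc, Category.id_comp]
      exact hn.w i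
    refine T.inverted_of_extension_of_lift r n hr (π i ≫ pullback.snd _ _) ?_
    rw [Category.assoc, ← pullback.condition]
    exact (reassoc_of% hi) _
  · have := T.isIso_eHomWhiskerRight_of_inverted f hf X
    exact (hnN f (Or.inr hf)).isIso

end Monads

/-! ### The idempotent monad of an enriched reflection -/

section Reflection

variable (V : Type u₁) [Category.{v₁} V] [MonoidalCategory V]
  {B : Type u₂} [Category.{v₂} B] [EnrichedOrdinaryCategory V B]
  {K : B → B} (r : ∀ X, X ⟶ K X)

/-- The unit of a `V`-reflection is invertible at the objects in the image of `K`. Its inverse is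
the multiplication of the associated `V`-monad. -/
lemma isIso_reflection_unit [∀ X Y, IsIso (eHomWhiskerRight V (r X) (K Y))]
    (X : B) : IsIso (r (K X)) := by
  obtain ⟨m, hm⟩ := exists_extension V (r (K X)) (𝟙 (K X))
  refine ⟨m, hm, extension_ext V (r _) ?_⟩
  rw [reassoc_of% hm, Category.comp_id]

/-- The action on hom-objects of the `V`-functor `K` that is part of a `V`-reflection with unit
`r`: the morphism `B(X, Y) ⟶ B(X, K Y) ≅ B(K X, K Y)`. -/
noncomputable def reflectionMap [∀ X Y, IsIso (eHomWhiskerRight V (r X) (K Y))]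
    (X Y : B) : (X ⟶[V] Y) ⟶ (K X ⟶[V] K Y) :=
  eHomWhiskerLeft V X (r Y) ≫ inv (eHomWhiskerRight V (r X) (K Y))

lemma reflectionMap_whiskerRight [∀ X Y, IsIso (eHomWhiskerRight V (r X) (K Y))]
    (X Y : B) :
    reflectionMap V r X Y ≫ eHomWhiskerRight V (r X) (K Y) = eHomWhiskerLeft V X (r Y) := by
  simp [reflectionMap]

/-- The `V`-functor underlying a `V`-reflection, given as a family of morphisms `r X : X ⟶ K X` with
`B(r X, K Y)` invertible for all `X` and `Y`. -/
noncomputable def reflectionFunctor [∀ X Y, IsIso (eHomWhiskerRight V (r X) (K Y))] :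
    EnrichedFunctor V B B where
  obj := K
  map := reflectionMap V r
  map_id X := by
    rw [← cancel_mono (eHomWhiskerRight V (r X) (K X)), Category.assoc,
      reflectionMap_whiskerRight, ← eHomEquiv_id, ← eHomEquiv_id,
      ← eHomEquiv_comp_eq_whiskerLeft, ← eHomEquiv_comp_eq_whiskerRight, Category.id_comp,
      Category.comp_id]
  map_comp X Y Z := by
    rw [← cancel_mono (eHomWhiskerRight V (r X) (K Z)), Category.assoc, Category.assoc,
      reflectionMap_whiskerRight, eComp_eHomWhiskerLeft,
      eComp_eHomWhiskerRight, MonoidalCategory.tensorHom_def', Category.assoc,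
      ← comp_whiskerRight_assoc, reflectionMap_whiskerRight,
      whiskerRight_eHomWhiskerLeft_eComp, ← MonoidalCategory.whiskerLeft_comp_assoc,
      reflectionMap_whiskerRight]

/-- The action of a `V`-reflection on the morphisms of the underlying category. -/
noncomputable def reflectionHom [∀ X Y, IsIso (eHomWhiskerRight V (r X) (K Y))]
    {X Y : B} (f : X ⟶ Y) : K X ⟶ K Y :=
  mapHom (reflectionFunctor V r) f

lemma unit_reflectionHom [∀ X Y, IsIso (eHomWhiskerRight V (r X) (K Y))]
    {X Y : B} (f : X ⟶ Y) :
    r X ≫ reflectionHom V r f = f ≫ r Y := by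
  apply (eHomEquiv V).injective
  rw [eHomEquiv_comp_eq_whiskerRight, eHomEquiv_comp_eq_whiskerLeft, ← reflectionMap_whiskerRight,
    ← Category.assoc]
  exact congrArg (· ≫ _) (eHomEquiv_mapHom (reflectionFunctor V r) f)

lemma reflectionHom_unit [∀ X Y, IsIso (eHomWhiskerRight V (r X) (K Y))]
    (X : B) : reflectionHom V r (r X) = r (K X) :=
  extension_ext V (r _) (unit_reflectionHom V r (r X))

/-- The `V`-naturality of the inverse `K ⟶ K K` of the multiplication. -/
lemma reflectionMap_comp_unit [∀ X Y, IsIso (eHomWhiskerRight V (r X) (K Y))]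
    (X Y : B) :
    reflectionMap V r X Y ≫ eHomWhiskerLeft V (K X) (r (K Y)) =
      (reflectionMap V r X Y ≫ reflectionMap V r (K X) (K Y)) ≫
        eHomWhiskerRight V (r (K X)) (K (K Y)) := by
  rw [Category.assoc, reflectionMap_whiskerRight]

/-- The `V`-naturality of the multiplication `K K ⟶ K`. -/
lemma reflectionMap_comp_mult [∀ X Y, IsIso (eHomWhiskerRight V (r X) (K Y))]
    [∀ X, IsIso (r (K X))] (X Y : B) :
    (reflectionMap V r X Y ≫ reflectionMap V r (K X) (K Y)) ≫
        eHomWhiskerLeft V (K (K X)) (inv (r (K Y))) =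
      reflectionMap V r X Y ≫ eHomWhiskerRight V (inv (r (K X))) (K Y) := by
  rw [← cancel_mono (eHomWhiskerRight V (r (K X)) (K Y))]
  simp only [Category.assoc, eHom_whisker_exchange]
  rw [reassoc_of% (reflectionMap_whiskerRight V r), ← eHomWhiskerLeft_comp,
    ← eHomWhiskerRight_comp, IsIso.hom_inv_id, IsIso.hom_inv_id, eHomWhiskerLeft_id,
    eHomWhiskerRight_id]

lemma reflectionHom_mult [∀ X Y, IsIso (eHomWhiskerRight V (r X) (K Y))]
    [∀ X, IsIso (r (K X))] (X : B) :
    reflectionHom V r (inv (r (K X))) = inv (r (K (K X))) := by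
  apply extension_ext V (r _)
  rw [unit_reflectionHom, IsIso.hom_inv_id, IsIso.inv_hom_id]

/-- The idempotent `V`-monad of a `V`-reflection. -/
noncomputable def reflectionMonad [∀ X Y, IsIso (eHomWhiskerRight V (r X) (K Y))] : VMonad V B :=
  have := isIso_reflection_unit V r
  { T := reflectionFunctor V r
    η := ⟨r, fun X Y => (Category.id_comp _).trans (reflectionMap_whiskerRight V r X Y).symm⟩
    μ := ⟨fun X => (inv (r (K X)) : K (K X) ⟶ K X), reflectionMap_comp_mult V r⟩
    assoc := fun X => congrArg (· ≫ inv (r (K X))) (reflectionHom_mult V r X)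
    left_unit := fun X => IsIso.hom_inv_id (r (K X))
    right_unit := fun X => (congrArg (· ≫ inv (r (K X))) (reflectionHom_unit V r X)).trans
      (IsIso.hom_inv_id (r (K X))) }

lemma isIdempotent_reflectionMonad [∀ X Y, IsIso (eHomWhiskerRight V (r X) (K Y))] :
    (reflectionMonad V r).IsIdempotent :=
  have := isIso_reflection_unit V r
  ⟨⟨fun X => r (K X), reflectionMap_comp_unit V r⟩, fun X => IsIso.inv_hom_id (r (K X)),
    fun X => IsIso.hom_inv_id (r (K X))⟩

/-- A `V`-reflection inverts each morphism to which all its values are `V`-orthogonal. -/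
lemma isIso_reflectionHom [∀ X Y, IsIso (eHomWhiskerRight V (r X) (K Y))]
    {X Y : B} (f : X ⟶ Y)
    (hf : ∀ Z, IsIso (eHomWhiskerRight V f (K Z))) : IsIso (reflectionHom V r f) := by
  obtain ⟨g, hg⟩ := exists_extension V f (r X)
  obtain ⟨g', hg'⟩ := exists_extension V (r Y) g
  refine ⟨g', extension_ext V (r _) ?_, extension_ext V (r _) ?_⟩
  · rw [reassoc_of% (unit_reflectionHom V r), hg', hg, Category.comp_id]
  · apply extension_ext V f
    rw [reassoc_of% hg', reassoc_of% hg, unit_reflectionHom, Category.comp_id]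

end Reflection

end EnrichedCore

theorem mainTheorem5
    {V : Type u₁} [Category.{v₁} V] [MonoidalCategory V] [SymmetricCategory V] [MonoidalClosed V]
    {B : Type u₂} [Category.{v₂} B] [EnrichedOrdinaryCategory V B]
    (E M : MorphismProperty B)
    (hEM : EnrichedCore.IsVPrefactorizationSystem V E M)
    (hproper : EnrichedCore.IsVProper V E M)
    (hB : EnrichedCore.IsSubobjectComplete V M)
    (T : EnrichedCore.VMonad V B) :
    ∃ S : EnrichedCore.VMonad V B, S.IsIdempotentCore T := by
  choose K r hr hK using T.exists_reflection hEM hproper hB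
  have hrK (X Y : B) : IsIso (eHomWhiskerRight V (r X) (K Y)) := hK Y (r X) (hr X)
  refine ⟨EnrichedCore.reflectionMonad V r, EnrichedCore.isIdempotent_reflectionMonad V r,
    fun X Y f => ⟨fun hf => ?_, fun hf => ?_⟩⟩
  · -- `T` inverts three sides of the naturality square of `r` at `f`, hence also the fourth.
    have : IsIso (EnrichedCore.reflectionHom V r f) := hf
    have : IsIso ((EnrichedCore.underlying T.T).map (r X)) := hr X
    have : IsIso ((EnrichedCore.underlying T.T).map (r Y)) := hr Y
    have h := congrArg (EnrichedCore.underlying T.T).map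
      (EnrichedCore.unit_reflectionHom V r f)
    rw [Functor.map_comp, Functor.map_comp] at h
    exact IsIso.of_isIso_fac_right h.symm
  · exact EnrichedCore.isIso_reflectionHom V r f fun Z => hK Z f hf
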